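/- Let $X$ and $Y$ be finite sets and $f:X\times Y\to\{0,1\}$. Let $M_f$ be the $|X|\times|Y|$ matrix with entries $M_f[x,y]=f(x,y)$, and let $\mathrm{rank}(f)$ be the rank of $M_f$ over the reals. Consider protocols in which Alice holds $x\in X$, Bob holds $y\in Y$, and they communicate classical bits and share prior entanglement. Initially they share $k$ EPR-pairs $\frac{1}{\sqrt2}(|00\rangle+|11\rangle)$, for some finite $k$, of which Alice holds the first and Bob the second qubits, and each party has finitely many further private qubits, all in state $|0\rangle$; the numbers of qubits are unrestricted and do not depend on the inputs. In each of $\ell$ rounds one party sends one classical bit to the other. Who sends is determined by the bits sent before (for instance by a fixed schedule). The sender applies to its own qubits a unitary that depends on its own input and the bits sent before, measures one fixed private qubit of its own in the computational basis, and sends the outcome. After the $\ell$ rounds each party applies to its own qubits one more unitary, which depends on its input and on all $\ell$ bits, and measures its fixed private qubit; the outcome is its output. The protocol computes $f$ exactly if for all $(x,y)\in X\times Y$, with probability $1$, both outputs equal $f(x,y)$. Let $C^*(f)$ be the minimal $\ell$ for which such a protocol that computes $f$ exactly exists. **Theorem.** For every such $f$, $$C^*(f)\ \ge\ \log_2 \mathrm{rank}(f).$$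 (For $f\equiv 0$, where $\mathrm{rank}(f)=0$, the inequality holds trivially, under the convention $\log_2 0=-\infty$ as well as under $\log_2 0=0$.) -/

import Mathlib

open scoped Matrix Kronecker

namespace QComm

/-- Strings of `n` bits; they label the computational basis of `n` qubits. -/
abbrev Bits (n : ℕ) : Type := Fin n → Bool

/-- Basis labels of the register of one party: its halves of the `k` shared EPR-pairs, and `a + 1`
private qubits. Private qubit `0` is the one that the party measures. -/
abbrev Register (k a : ℕ) : Type := Bits k × Bits (a + 1)

/-- (Unnormalized) joint pure states of Alice and Bob, as vectors of amplitudes. -/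
abbrev JointState (k a b : ℕ) : Type := Register k a × Register k b → ℂ

/-- The amplitudes of the EPR-pair `(|00⟩ + |11⟩) / √2`. -/
noncomputable def eprPair (p q : Bool) : ℂ := if p = q then ((Real.sqrt 2 : ℝ) : ℂ)⁻¹ else 0

/-- The amplitudes of the qubit state `|0⟩`. -/
def ketZero (p : Bool) : ℂ := if p = false then 1 else 0

/-- `k` EPR-pairs shared between Alice and Bob, all other qubits being zero. -/
noncomputable def initialState (k a b : ℕ) : JointState k a b := fun s =>
  (∏ i, eprPair (s.1.1 i) (s.2.1 i)) * (∏ i, ketZero (s.1.2 i)) * ∏ i, ketZero (s.2.2 i)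

/-- Unnormalized state after Alice measured her private qubit `0` with outcome `c`. -/
def measureAlice {k a b : ℕ} (c : Bool) (ψ : JointState k a b) : JointState k a b :=
  fun s => if s.1.2 0 = c then ψ s else 0

/-- Unnormalized state after Bob measured his private qubit `0` with outcome `c`. -/
def measureBob {k a b : ℕ} (c : Bool) (ψ : JointState k a b) : JointState k a b :=
  fun s => if s.2.2 0 = c then ψ s else 0

/-- The two players. -/
inductive Party : Type
  | alice
  | bob

/-- A protocol that communicates classical bits and uses shared EPR-pairs. Transcripts are lists of
the bits sent so far, the most recent bit first. The party who sends the next bit is determined by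
the transcript. It applies a unitary, which depends on its own input and on the transcript, to its
own register, measures its private qubit `0` in the computational basis, and sends the outcome.
After `cost` bits each party applies one more such unitary and measures its private qubit `0`;
the outcome is its output. -/
structure Protocol (X Y : Type*) where
  /-- number of classical bits that are communicated -/
  cost : ℕ
  /-- number of shared EPR-pairs -/
  epr : ℕ
  /-- Alice has `ancA + 1` private qubits -/
  ancA : ℕ
  /-- Bob has `ancB + 1` private qubits -/
  ancB : ℕ
  /-- the sender of the next bit -/
  sender : List Bool → Party
  /-- Alice's unitaries -/
  UA : X → List Bool → Matrix.unitaryGroup (Register epr ancA) ℂ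
  /-- Bob's unitaries -/
  UB : Y → List Bool → Matrix.unitaryGroup (Register epr ancB) ℂ

namespace Protocol

variable {X Y : Type*} (P : Protocol X Y)

/-- The unnormalized joint state, on inputs `x`, `y`, when the bits in the transcript have been
sent; its squared norm is the probability of that transcript. -/
noncomputable def branch (x : X) (y : Y) : List Bool → JointState P.epr P.ancA P.ancB
  | [] => initialState P.epr P.ancA P.ancB
  | c :: h =>
    match P.sender h with
    | .alice => measureAlice c
        (((P.UA x h).1 ⊗ₖ (1 : Matrix (Register P.epr P.ancB) (Register P.epr P.ancB) ℂ)) *ᵥ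
          branch x y h)
    | .bob => measureBob c
        (((1 : Matrix (Register P.epr P.ancA) (Register P.epr P.ancA) ℂ) ⊗ₖ (P.UB y h).1) *ᵥ
          branch x y h)

/-- The unnormalized joint state for a complete transcript, just before the outputs are measured. -/
noncomputable def finalState (x : X) (y : Y) (h : List Bool) : JointState P.epr P.ancA P.ancB :=
  ((P.UA x h).1 ⊗ₖ (P.UB y h).1) *ᵥ P.branch x y h

/-- The probability, on inputs `x`, `y`, that Alice outputs `p` and Bob outputs `q`. -/
noncomputable def outputProb (x : X) (y : Y) (p q : Bool) : ℝ :=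
  ∑ t : Bits P.cost, ∑ s,
    ‖measureAlice p (measureBob q (P.finalState x y (List.ofFn t))) s‖ ^ 2

/-- The protocol computes `f` exactly: on every input, with certainty, both parties end up
knowing the value of `f`. -/
def Computes (f : X → Y → Bool) : Prop :=
  ∀ x y, P.outputProb x y (f x y) (f x y) = 1

end Protocol

/-- `C*(f)`: the least number of classical bits in an exact protocol for `f` with (finitely, but
arbitrarily many) shared EPR-pairs. -/
noncomputable def cStar {X Y : Type*} (f : X → Y → Bool) : ℕ :=
  sInf {l : ℕ | ∃ P : Protocol X Y, P.cost = l ∧ P.Computes f}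

/-- The communication matrix of `f`. -/
def commMatrix {X Y : Type*} (f : X → Y → Bool) : Matrix X Y ℝ :=
  Matrix.of fun x y => if f x y then 1 else 0

/-! The set in the definition of `cStar` is never empty when `X` is finite: Alice can send her
whole input, and Bob the answer. -/

lemma reg_sum {M : Type*} [AddCommMonoid M] (g : Register 0 0 → M) :
    ∑ r, g r = g (default, fun _ => true) + g (default, fun _ => false) := by
  rw [Fintype.sum_prod_type, Fintype.sum_subsingleton _ default]
  have := (Equiv.funUnique (Fin 1) Bool).symm.sum_comp (fun r => g (default, r))
  rw [Fintype.sum_bool] at this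
  exact this.symm

lemma pair_sum {M : Type*} [AddCommMonoid M] (g : Register 0 0 × Register 0 0 → M) :
    ∑ s, g s = ∑ r, ∑ s, g (r, s) := Fintype.sum_prod_type _

/-- The bit flip of the private qubit if `c` holds, and the identity otherwise. -/
def flipMat (c : Bool) : Matrix (Register 0 0) (Register 0 0) ℂ :=
  Matrix.of fun r r' => if r.2 0 = (c ^^ r'.2 0) then 1 else 0

lemma flipMat_mem (c : Bool) : flipMat c ∈ Matrix.unitaryGroup (Register 0 0) ℂ := by
  rw [Matrix.mem_unitaryGroup_iff]
  ext ⟨r0, r⟩ ⟨s0, s⟩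
  obtain rfl := Subsingleton.elim r0 s0
  have e : (((r0, r) : Register 0 0) = (r0, s)) ↔ r 0 = s 0 := by
    simp [funext_iff, Fin.forall_fin_one]
  simp only [Matrix.mul_apply, Matrix.star_apply, Matrix.one_apply, flipMat, Matrix.of_apply, e]
  rw [reg_sum]
  rcases Bool.eq_false_or_eq_true (r 0) with hu | hu <;>
    rcases Bool.eq_false_or_eq_true (s 0) with hv | hv <;> cases c <;> simp [hu, hv]

/-- The sequence of private bits `0` of Alice and Bob in a deterministic protocol. -/
def cur (sender : List Bool → Party) : List Bool → Bool × Bool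
  | [] => (false, false)
  | c :: h => match sender h with
    | .alice => (c, (cur sender h).2)
    | .bob => ((cur sender h).1, c)

abbrev detProtocol {X Y : Type*} (l : ℕ) (sender : List Bool → Party)
    (α : X → List Bool → Bool) (β : Y → List Bool → Bool) : Protocol X Y where
  cost := l
  epr := 0
  ancA := 0
  ancB := 0
  sender := sender
  UA x h := ⟨flipMat (α x h ^^ (cur sender h).1), flipMat_mem _⟩
  UB y h := ⟨flipMat (β y h ^^ (cur sender h).2), flipMat_mem _⟩

def next {X Y : Type*} (sender : List Bool → Party)
    (α : X → List Bool → Bool) (β : Y → List Bool → Bool) (x : X) (y : Y) (h : List Bool) : Bool :=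
  match sender h with
  | .alice => α x h
  | .bob => β y h

def path {X Y : Type*} (sender : List Bool → Party)
    (α : X → List Bool → Bool) (β : Y → List Bool → Bool) (x : X) (y : Y) : ℕ → List Bool
  | 0 => []
  | n + 1 => next sender α β x y (path sender α β x y n) :: path sender α β x y n

def basisState (p : Bool × Bool) : JointState 0 0 0 := fun s =>
  if s.1.2 0 = p.1 ∧ s.2.2 0 = p.2 then 1 else 0

lemma initialState_eq : initialState 0 0 0 = basisState (false, false) := by
  ext ⟨⟨r0, r⟩, ⟨s0, s⟩⟩
  simp only [initialState, basisState, ketZero]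
  rcases Bool.eq_false_or_eq_true (r 0) with hu | hu <;>
    rcases Bool.eq_false_or_eq_true (s 0) with hv | hv <;> simp [hu, hv]

lemma measureAlice_basis (c p q : Bool) :
    measureAlice c (basisState (p, q)) = if c = p then basisState (c, q) else 0 := by
  ext ⟨⟨r0, r⟩, ⟨s0, s⟩⟩
  simp only [measureAlice, basisState]
  rcases Bool.eq_false_or_eq_true (r 0) with hu | hu <;> cases c <;> cases p <;>
    simp [hu, basisState]

lemma measureBob_basis (c p q : Bool) :
    measureBob c (basisState (p, q)) = if c = q then basisState (p, c) else 0 := by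
  ext ⟨⟨r0, r⟩, ⟨s0, s⟩⟩
  simp only [measureBob, basisState]
  rcases Bool.eq_false_or_eq_true (s 0) with hu | hu <;> cases c <;> cases q <;>
    simp [hu, basisState]

lemma kron_flip (A B : Matrix (Register 0 0) (Register 0 0) ℂ) (c d : Bool)
    (hA : A = flipMat c) (hB : B = flipMat d) (p : Bool × Bool) :
    (A ⊗ₖ B) *ᵥ basisState p = basisState (c ^^ p.1, d ^^ p.2) := by
  subst hA hB
  obtain ⟨p, q⟩ := p
  ext ⟨⟨r0, r⟩, ⟨s0, s⟩⟩
  simp only [Matrix.mulVec, dotProduct, Matrix.kroneckerMap_apply, flipMat, Matrix.of_apply,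
    basisState]
  rw [pair_sum]
  simp only [reg_sum]
  rcases Bool.eq_false_or_eq_true (r 0) with hu | hu <;>
    rcases Bool.eq_false_or_eq_true (s 0) with hv | hv <;>
    cases c <;> cases d <;> cases p <;> cases q <;> simp [hu, hv]

lemma flip_false : (1 : Matrix (Register 0 0) (Register 0 0) ℂ) = flipMat false := by
  ext ⟨r0, r⟩ ⟨s0, s⟩
  obtain rfl := Subsingleton.elim r0 s0
  simp [flipMat, Matrix.one_apply, funext_iff, Fin.forall_fin_one]

lemma path_length {X Y : Type*} (sender : List Bool → Party)
    (α : X → List Bool → Bool) (β : Y → List Bool → Bool) (x : X) (y : Y) (n : ℕ) :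
    (path sender α β x y n).length = n := by
  induction n with
  | zero => rfl
  | succ n ih => simp [path, ih]

lemma branch_det {X Y : Type*} (l : ℕ) (sender : List Bool → Party)
    (α : X → List Bool → Bool) (β : Y → List Bool → Bool) (x : X) (y : Y) (h : List Bool) :
    (detProtocol l sender α β).branch x y h =
      if h = path sender α β x y h.length then basisState (cur sender h) else 0 := by
  induction h with
  | nil =>
    simp only [Protocol.branch, path, List.length_nil, if_true, cur]
    exact initialState_eq
  | cons c h ih =>
    simp only [Protocol.branch, List.length_cons, path, List.cons.injEq]
    rw [ih]
    by_cases hp : h = path sender α β x y h.length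
    · rw [if_pos hp, ← hp]
      simp only [and_true]
      cases hh : sender h with
      | alice =>
        simp only [next, hh, cur]
        erw [kron_flip _ _ _ _ rfl flip_false]
        rw [Bool.xor_assoc, Bool.xor_self, Bool.xor_false, Bool.false_xor]
        exact measureAlice_basis _ _ _
      | bob =>
        simp only [next, hh, cur]
        erw [kron_flip _ _ _ _ flip_false rfl]
        rw [Bool.xor_assoc, Bool.xor_self, Bool.xor_false, Bool.false_xor]
        exact measureBob_basis _ _ _
    · rw [if_neg hp]
      simp only [hp, and_false, if_false]
      cases sender h <;> ext s
      · exact ite_eq_right_iff.2 fun _ => congrFun (Matrix.mulVec_zero _) s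
      · exact ite_eq_right_iff.2 fun _ => congrFun (Matrix.mulVec_zero _) s

lemma det_computes {X Y : Type*} (l : ℕ) (sender : List Bool → Party)
    (α : X → List Bool → Bool) (β : Y → List Bool → Bool) (f : X → Y → Bool)
    (hα : ∀ x y, α x (path sender α β x y l) = f x y)
    (hβ : ∀ x y, β y (path sender α β x y l) = f x y) :
    (detProtocol l sender α β).Computes f := by
  intro x y
  unfold Protocol.outputProb
  have hfin : ∀ h : List Bool, h.length = l → (detProtocol l sender α β).finalState x y h =
      if h = path sender α β x y l then basisState (f x y, f x y) else 0 := by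
    intro h hl
    unfold Protocol.finalState
    rw [branch_det, hl]
    split_ifs with hp
    · erw [kron_flip _ _ _ _ rfl rfl]
      rw [hp, hα, hβ, Bool.xor_assoc, Bool.xor_self, Bool.xor_false,
        Bool.xor_assoc, Bool.xor_self, Bool.xor_false]
    · exact Matrix.mulVec_zero _
  obtain ⟨t₀, ht₀⟩ : ∃ t : Bits l, List.ofFn t = path sender α β x y l := by
    have hl := path_length sender α β x y l
    refine ⟨fun i => (path sender α β x y l).get (i.cast hl.symm), ?_⟩
    apply List.ext_get
    · simp [hl]
    · simp
  refine (Finset.sum_eq_single t₀ ?_ ?_).trans ?_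
  · intro t _ ht
    have hne : List.ofFn t ≠ path sender α β x y l := fun e =>
      ht (List.ofFn_injective (e.trans ht₀.symm))
    rw [hfin _ List.length_ofFn, if_neg hne]
    apply Finset.sum_eq_zero
    intro s _
    simp [measureAlice, measureBob]
  · intro h
    exact absurd (Finset.mem_univ _) h
  · rw [hfin _ List.length_ofFn, if_pos ht₀]
    change ∑ s : Register 0 0 × Register 0 0, ‖measureAlice (k := 0) (a := 0) (b := 0) (f x y)
      (measureBob (f x y) (basisState (f x y, f x y))) s‖ ^ 2 = 1
    rw [pair_sum]
    simp only [reg_sum, measureAlice, measureBob, basisState]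
    cases f x y <;> simp

/-- Every `f` on finite sets has an exact protocol, so the infimum in `cStar` is attained. -/
theorem exists_protocol {X Y : Type*} [Finite X] (f : X → Y → Bool) :
    ∃ l : ℕ, ∃ P : Protocol X Y, P.cost = l ∧ P.Computes f := by
  classical
  obtain ⟨n, ⟨e⟩⟩ := Finite.exists_equiv_fin X
  let sender : List Bool → Party := fun h => if h.length < n then .alice else .bob
  let α₀ : X → ℕ → Bool := fun x i => decide ((e x : ℕ) = i)
  let enc : X → ℕ → List Bool := fun x m => Nat.rec (motive := fun _ => List Bool) [] (fun i l => α₀ x i :: l) m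
  let α : X → List Bool → Bool := fun x h => if h.length < n then α₀ x h.length else h.headD false
  let β : Y → List Bool → Bool := fun y h =>
    if h.length ≤ n then decide (∃ x : X, enc x n = h ∧ f x y = true) else h.headD false
  have henc : ∀ x m i, i < m → ((enc x m)[m - 1 - i]?) = some (α₀ x i) := by
    intro x m
    induction m with
    | zero => intro i hi; omega
    | succ m ih =>
      intro i hi
      change ((α₀ x m :: enc x m)[m + 1 - 1 - i]?) = _
      by_cases him : i = m
      · subst him; simp
      · have : m + 1 - 1 - i = (m - 1 - i) + 1 := by omega
        rw [this, List.getElem?_cons_succ]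
        exact ih i (by omega)
  have hinj : ∀ x x', enc x n = enc x' n → x = x' := by
    intro x x' hxx
    have h1 := henc x n (e x) (e x).2
    rw [hxx, henc x' n (e x) (e x).2] at h1
    simp only [α₀, Option.some.injEq, decide_true, decide_eq_true_eq] at h1
    exact (e.injective (Fin.ext h1)).symm
  have hpath : ∀ x y m, m ≤ n → path sender α β x y m = enc x m := by
    intro x y m
    induction m with
    | zero => intro _; rfl
    | succ m ih =>
      intro hm
      have hl := path_length sender α β x y m
      change next sender α β x y (path sender α β x y m) :: path sender α β x y m
        = α₀ x m :: enc x m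
      rw [← ih (by omega)]
      congr 1
      have hs : sender (path sender α β x y m) = .alice := if_pos (by omega)
      simp only [next, hs]
      exact (if_pos (by omega)).trans (by rw [hl])
  have hlast : ∀ x y, path sender α β x y (n + 1) = f x y :: enc x n := by
    intro x y
    have hl := path_length sender α β x y n
    change next sender α β x y (path sender α β x y n) :: path sender α β x y n = _
    rw [hpath x y n le_rfl] at hl ⊢
    congr 1
    simp only [next, sender, β, hl, lt_irrefl, if_false, le_refl, if_true]
    cases hf : f x y
    · simp only [decide_eq_false_iff_not, not_exists, not_and]
      intro x' hx'
      rw [hinj _ _ hx', hf]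
      decide
    · exact decide_eq_true ⟨x, rfl, hf⟩
  have hlen : ∀ x, (enc x n).length = n := by
    intro x
    have : ∀ m, (enc x m).length = m := by
      intro m
      induction m with
      | zero => rfl
      | succ m ih => exact congrArg (· + 1) ih
    exact this n
  refine ⟨n + 1, detProtocol (n + 1) sender α β, rfl, det_computes _ _ _ _ _ ?_ ?_⟩
  · intro x y
    rw [hlast]
    simp [α, hlen]
  · intro x y
    rw [hlast]
    simp [β, hlen]

end QComm

namespace QComm

open Matrix

/-! For a fixed transcript `t` all operations are local, so the unnormalized final state is `(A ⊗ B)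
ψ` with `A` depending on `x, t`, `B` on `y, t`, and `ψ` the initial state. Let `E` be the sum over
`t` of `AᴴA ⊗ BᴴB`, with both outputs measured as 1. Exactness makes `ψ` an eigenvector of `E` with
eigenvalue `f x y` (`Computes.effect_mulVec`), which says more than the acceptance probability
alone.

Since `ψ` is maximally entangled, the coordinates of this equation at zero private qubits
(`Computes.sum_mul_eq`) say that `M_f ⊗ 1`, with `1` of size `2 ^ k`, factors through dimension `2 ^
ℓ * 2 ^ k`. Hence `rank M_f * 2 ^ k ≤ 2 ^ ℓ * 2 ^ k`, and the dimension of the entanglement cancels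
(`rank_le_of_kronecker_one_eq_mul`). -/

/-! ### Linear algebra: rank and factorization of `M ⊗ 1`. -/

/-- A real matrix of rank `r` has the `r × r` identity matrix as a two-sided multiple. -/
lemma exists_mul_mul_eq_one {X Y : Type*} [Fintype X] [Fintype Y] (M : Matrix X Y ℝ) :
    ∃ (P : Matrix (Fin M.rank) X ℝ) (Q : Matrix Y (Fin M.rank) ℝ), P * M * Q = 1 := by
  classical
  let e : LinearMap.range M.mulVecLin ≃ₗ[ℝ] (Fin M.rank → ℝ) :=
    (Module.finBasis ℝ (LinearMap.range M.mulVecLin)).equivFun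
  -- `g` is a section of `M` over its range and `h` a retraction onto the range; in the coordinates
  -- `e`, the composite of `g`, `M` and `h` is the identity.
  obtain ⟨g, hg⟩ := M.mulVecLin.rangeRestrict.exists_rightInverse_of_surjective
    M.mulVecLin.range_rangeRestrict
  obtain ⟨h, hh⟩ := (LinearMap.range M.mulVecLin).subtype.exists_leftInverse_of_injective
    (Submodule.ker_subtype _)
  refine ⟨LinearMap.toMatrix' (e.toLinearMap ∘ₗ h),
    LinearMap.toMatrix' (g ∘ₗ e.symm.toLinearMap), ?_⟩
  have hM : M = LinearMap.toMatrix' M.mulVecLin := (LinearMap.toMatrix'_toLin' M).symm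
  refine (congrArg (LinearMap.toMatrix' (e.toLinearMap ∘ₗ h) * · *
    LinearMap.toMatrix' (g ∘ₗ e.symm.toLinearMap)) hM).trans ?_
  rw [← LinearMap.toMatrix'_comp, ← LinearMap.toMatrix'_comp, ← LinearMap.toMatrix'_id]
  congr 1
  ext1 i
  ext1
  have h1 : ∀ v, M.mulVecLin (g v) = v := fun v =>
    congrArg Subtype.val (LinearMap.congr_fun hg v)
  have h2 : ∀ v : LinearMap.range M.mulVecLin, h v = v := fun v => LinearMap.congr_fun hh v
  simp only [LinearMap.comp_apply, LinearEquiv.coe_coe, h1, h2, LinearEquiv.apply_symm_apply,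
    LinearMap.id_apply]

/-- If `M ⊗ 1` factors over the complex numbers through dimension `|T| * |K|`, where `1` is the
identity on `K`, then the rank of `M` is at most `|T|`. -/
lemma rank_le_of_kronecker_one_eq_mul {X Y T K : Type*} [Fintype X] [Fintype Y] [Fintype T]
    [Fintype K] [DecidableEq K] [Nonempty K] (M : Matrix X Y ℝ)
    (L : Matrix (X × K) (T × K) ℂ) (R : Matrix (T × K) (Y × K) ℂ)
    (h : M.map (fun r : ℝ => (r : ℂ)) ⊗ₖ (1 : Matrix K K ℂ) = L * R) :
    M.rank ≤ Fintype.card T := by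
  obtain ⟨P, Q, hPQ⟩ := exists_mul_mul_eq_one M
  -- The identity `P * M * Q = 1` survives extension of scalars, so real and complex ranks need not
  -- be compared.
  have hc : P.map Complex.ofRealHom * M.map Complex.ofRealHom * Q.map Complex.ofRealHom = 1 := by
    rw [← Matrix.map_mul, ← Matrix.map_mul, hPQ, Matrix.map_one _ (map_zero _) (map_one _)]
  have h1 : (1 : Matrix (Fin M.rank × K) (Fin M.rank × K) ℂ) =
      ((P.map Complex.ofRealHom ⊗ₖ (1 : Matrix K K ℂ)) * L) *
        (R * (Q.map Complex.ofRealHom ⊗ₖ (1 : Matrix K K ℂ))) := by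
    rw [Matrix.mul_assoc, ← Matrix.mul_assoc L, ← h, ← mul_kronecker_mul, ← mul_kronecker_mul,
      Matrix.one_mul, Matrix.one_mul, ← Matrix.mul_assoc]
    exact (one_kronecker_one.symm).trans (congrArg (· ⊗ₖ (1 : Matrix K K ℂ)) hc.symm)
  have h2 := congrArg Matrix.rank h1
  rw [Matrix.rank_one, Fintype.card_prod, Fintype.card_fin] at h2
  have h3 := (h2.trans_le (Matrix.rank_mul_le_left _ _)).trans (Matrix.rank_le_card_width _)
  rw [Fintype.card_prod] at h3
  exact Nat.le_of_mul_le_mul_right h3 Fintype.card_pos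

/-! ### The shared initial state. -/

/-- The register basis state labelled by `w` whose private qubits are all zero. -/
def zeroPriv {k : ℕ} (a : ℕ) (w : Bits k) : Register k a := (w, fun _ => false)

/-- The common nonzero amplitude of `k` EPR-pairs. -/
noncomputable def eprAmp (k : ℕ) : ℂ := (((Real.sqrt 2 : ℝ) : ℂ)⁻¹) ^ k

lemma eprAmp_ne_zero (k : ℕ) : eprAmp k ≠ 0 := by
  simp [eprAmp]

lemma card_mul_eprAmp_sq (k : ℕ) : (Fintype.card (Bits k) : ℂ) * (eprAmp k * eprAmp k) = 1 := by
  have h : (2 : ℂ) * (((Real.sqrt 2 : ℝ) : ℂ)⁻¹ * ((Real.sqrt 2 : ℝ) : ℂ)⁻¹) = 1 := by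
    rw [← mul_inv, ← Complex.ofReal_mul, Real.mul_self_sqrt (by norm_num)]
    norm_num
  simp only [eprAmp, Fintype.card_fun, Fintype.card_bool, Fintype.card_fin, Nat.cast_pow,
    Nat.cast_ofNat]
  rw [← mul_pow, ← mul_pow, h, one_pow]

lemma star_eprAmp (k : ℕ) : star (eprAmp k) = eprAmp k := by
  simp [eprAmp]

lemma initialState_apply (k a b : ℕ) (s : Register k a × Register k b) :
    initialState k a b s =
      if s = (zeroPriv a s.1.1, zeroPriv b s.1.1) then eprAmp k else 0 := by
  obtain ⟨⟨u, p⟩, ⟨v, q⟩⟩ := s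
  simp only [initialState, eprPair, ketZero, zeroPriv, Prod.mk.injEq, true_and]
  by_cases hp : p = fun _ => false
  · by_cases hq : q = fun _ => false
    · by_cases hv : v = u
      · subst hp hq hv
        simp [eprAmp]
      · obtain ⟨i, hi⟩ := Function.ne_iff.1 hv
        rw [Finset.prod_eq_zero (Finset.mem_univ i) (if_neg (Ne.symm hi)), if_neg (by tauto)]
        simp
    · obtain ⟨i, hi⟩ := Function.ne_iff.1 hq
      rw [Finset.prod_eq_zero (f := fun i => if q i = false then (1 : ℂ) else 0)
        (Finset.mem_univ i) (if_neg hi), if_neg (by tauto), mul_zero]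
  · obtain ⟨i, hi⟩ := Function.ne_iff.1 hp
    rw [Finset.prod_eq_zero (f := fun i => if p i = false then (1 : ℂ) else 0)
      (Finset.mem_univ i) (if_neg hi), if_neg (by tauto), mul_zero, zero_mul]

lemma initialState_zeroPriv (k a b : ℕ) (u v : Bits k) :
    initialState k a b (zeroPriv a u, zeroPriv b v) = if u = v then eprAmp k else 0 := by
  rw [initialState_apply]
  simp [zeroPriv, eq_comm]

/-- Only the diagonal labels carry amplitude. Applied to a row of `A ⊗ B`, this turns the tensor
product into entries of `A * Bᵀ`, restricted to zero private qubits. -/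
lemma sum_mul_initialState (k a b : ℕ) (g : Register k a × Register k b → ℂ) :
    ∑ s, g s * initialState k a b s = (∑ w, g (zeroPriv a w, zeroPriv b w)) * eprAmp k := by
  rw [Finset.sum_mul]
  symm
  refine Finset.sum_of_injOn (fun w => (zeroPriv a w, zeroPriv b w)) ?_ ?_ ?_ ?_
  · intro u _ v _ h
    exact congrArg (fun s => s.1.1) h
  · simp
  · intro s _ hs
    rw [initialState_apply, if_neg, mul_zero]
    intro h
    exact hs ⟨s.1.1, by simp, h.symm⟩
  · intro w _
    rw [initialState_zeroPriv, if_pos rfl]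

lemma star_initialState_dotProduct (k a b : ℕ) :
    star (initialState k a b) ⬝ᵥ initialState k a b = 1 := by
  rw [dotProduct, sum_mul_initialState]
  simp only [Pi.star_apply, initialState_zeroPriv, if_true, star_eprAmp, Finset.sum_const,
    Finset.card_univ, nsmul_eq_mul]
  rw [mul_assoc, card_mul_eprAmp_sq]

/-! ### Measurements as local operators. -/

/-- The projection onto the states whose private qubit `0` is `c`. -/
def proj {k a : ℕ} (c : Bool) : Matrix (Register k a) (Register k a) ℂ :=
  diagonal fun r => if r.2 0 = c then 1 else 0

lemma measureAlice_eq {k a b : ℕ} (c : Bool) (ψ : JointState k a b) :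
    measureAlice c ψ = (proj c ⊗ₖ (1 : Matrix (Register k b) (Register k b) ℂ)) *ᵥ ψ := by
  ext s
  rw [proj, ← diagonal_one, diagonal_kronecker_diagonal, mulVec_diagonal]
  simp [measureAlice]

lemma measureBob_eq {k a b : ℕ} (c : Bool) (ψ : JointState k a b) :
    measureBob c ψ = ((1 : Matrix (Register k a) (Register k a) ℂ) ⊗ₖ proj c) *ᵥ ψ := by
  ext s
  rw [proj, ← diagonal_one, diagonal_kronecker_diagonal, mulVec_diagonal]
  simp [measureBob]

/-- Measuring after a unitary is a complete measurement. -/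
lemma sum_conjTranspose_mul_proj {k a : ℕ} (U : Matrix.unitaryGroup (Register k a) ℂ) :
    ∑ c, (proj c * U.1)ᴴ * (proj c * U.1) = 1 := by
  have h : ∑ c, (proj (k := k) (a := a) c)ᴴ * proj c = 1 := by
    rw [Fintype.sum_bool]
    simp only [proj, diagonal_conjTranspose, diagonal_mul_diagonal, diagonal_add]
    rw [← diagonal_one]
    congr 1
    ext r
    cases hr : r.2 0 <;> simp [hr]
  simp only [conjTranspose_mul, Matrix.mul_assoc]
  simp only [← Matrix.mul_assoc (proj _)ᴴ, ← Matrix.mul_sum, ← Matrix.sum_mul, h]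
  rw [Matrix.one_mul]
  exact Matrix.mem_unitaryGroup_iff'.1 U.2

lemma sum_norm_sq_mulVec {m n : Type*} [Fintype m] [Fintype n] (M : Matrix m n ℂ) (v : n → ℂ) :
    ((∑ s, ‖(M *ᵥ v) s‖ ^ 2 : ℝ) : ℂ) = star v ⬝ᵥ ((Mᴴ * M) *ᵥ v) := by
  rw [← mulVec_mulVec, dotProduct_mulVec, ← star_mulVec]
  push_cast
  refine Finset.sum_congr rfl fun s _ => ?_
  exact (Complex.conj_mul' _).symm

/-- Transcripts carry the newest bit at the head, so the bit split off here is the last one sent. -/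
lemma sum_bits_succ {M : Type*} [AddCommMonoid M] (n : ℕ) (g : List Bool → M) :
    ∑ t : Bits (n + 1), g (List.ofFn t) = ∑ t : Bits n, ∑ c, g (c :: List.ofFn t) := by
  rw [← (Fin.consEquiv fun _ : Fin (n + 1) => Bool).sum_comp, Fintype.sum_prod_type_right]
  simp [Fin.consEquiv]

/-! ### Transcripts as products of local operators. -/

namespace Protocol

variable {X Y : Type*} (P : Protocol X Y)

/-- The product of all operators that Alice applies while the transcript is built up. -/
noncomputable def opA (x : X) : List Bool → Matrix (Register P.epr P.ancA) (Register P.epr P.ancA) ℂ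
  | [] => 1
  | c :: h =>
    match P.sender h with
    | .alice => proj c * (P.UA x h).1 * opA x h
    | .bob => opA x h

/-- The product of all operators that Bob applies while the transcript is built up. -/
noncomputable def opB (y : Y) : List Bool → Matrix (Register P.epr P.ancB) (Register P.epr P.ancB) ℂ
  | [] => 1
  | c :: h =>
    match P.sender h with
    | .alice => opB y h
    | .bob => proj c * (P.UB y h).1 * opB y h

lemma branch_eq (x : X) (y : Y) (h : List Bool) :
    P.branch x y h = (P.opA x h ⊗ₖ P.opB y h) *ᵥ initialState P.epr P.ancA P.ancB := by
  induction h with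
  | nil => simp [branch, opA, opB]
  | cons c h ih =>
    cases hs : P.sender h with
    | alice =>
      simp only [branch, opA, opB, hs, ih, measureAlice_eq, mulVec_mulVec, ← mul_kronecker_mul,
        Matrix.one_mul, Matrix.mul_assoc]
    | bob =>
      simp only [branch, opA, opB, hs, ih, measureBob_eq, mulVec_mulVec, ← mul_kronecker_mul,
        Matrix.one_mul, Matrix.mul_assoc]

/-- All operators of Alice on a transcript, including the measurement of her output `p`. -/
noncomputable def finA (x : X) (h : List Bool) (p : Bool) :
    Matrix (Register P.epr P.ancA) (Register P.epr P.ancA) ℂ :=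
  proj p * (P.UA x h).1 * P.opA x h

/-- All operators of Bob on a transcript, including the measurement of his output `q`. -/
noncomputable def finB (y : Y) (h : List Bool) (q : Bool) :
    Matrix (Register P.epr P.ancB) (Register P.epr P.ancB) ℂ :=
  proj q * (P.UB y h).1 * P.opB y h

lemma measure_finalState_eq (x : X) (y : Y) (h : List Bool) (p q : Bool) :
    measureAlice p (measureBob q (P.finalState x y h)) =
      (P.finA x h p ⊗ₖ P.finB y h q) *ᵥ initialState P.epr P.ancA P.ancB := by
  simp only [finalState, branch_eq, finA, finB, measureAlice_eq, measureBob_eq, mulVec_mulVec,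
    ← mul_kronecker_mul, Matrix.one_mul, Matrix.mul_assoc]

lemma sum_kraus_alice {k a b : ℕ} (U : Matrix.unitaryGroup (Register k a) ℂ)
    (A : Matrix (Register k a) (Register k a) ℂ) (B : Matrix (Register k b) (Register k b) ℂ) :
    ∑ c, ((proj c * U.1 * A) ⊗ₖ B)ᴴ * ((proj c * U.1 * A) ⊗ₖ B) = (A ⊗ₖ B)ᴴ * (A ⊗ₖ B) := by
  simp only [conjTranspose_kronecker, ← mul_kronecker_mul]
  have h : ∑ c, (proj c * U.1 * A)ᴴ * (proj c * U.1 * A) = Aᴴ * A := by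
    have e : ∀ c, (proj c * U.1 * A)ᴴ * (proj c * U.1 * A) =
        Aᴴ * ((proj c * U.1)ᴴ * (proj c * U.1)) * A := fun c => by
      rw [conjTranspose_mul _ A]
      simp only [Matrix.mul_assoc]
    simp only [e, ← Matrix.mul_sum, ← Matrix.sum_mul, sum_conjTranspose_mul_proj, Matrix.mul_one]
  rw [← h, Fintype.sum_bool, Fintype.sum_bool, add_kronecker]

lemma sum_kraus_bob {k a b : ℕ} (U : Matrix.unitaryGroup (Register k b) ℂ)
    (A : Matrix (Register k a) (Register k a) ℂ) (B : Matrix (Register k b) (Register k b) ℂ) :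
    ∑ c, (A ⊗ₖ (proj c * U.1 * B))ᴴ * (A ⊗ₖ (proj c * U.1 * B)) = (A ⊗ₖ B)ᴴ * (A ⊗ₖ B) := by
  simp only [conjTranspose_kronecker, ← mul_kronecker_mul]
  have h : ∑ c, (proj c * U.1 * B)ᴴ * (proj c * U.1 * B) = Bᴴ * B := by
    have e : ∀ c, (proj c * U.1 * B)ᴴ * (proj c * U.1 * B) =
        Bᴴ * ((proj c * U.1)ᴴ * (proj c * U.1)) * B := fun c => by
      rw [conjTranspose_mul _ B]
      simp only [Matrix.mul_assoc]
    simp only [e, ← Matrix.mul_sum, ← Matrix.sum_mul, sum_conjTranspose_mul_proj, Matrix.mul_one]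
  rw [← h, Fintype.sum_bool, Fintype.sum_bool, kronecker_add]

/-- Completeness of the sender's measurement sums out the last bit, whoever sent it; the sender
depends only on the earlier bits. -/
lemma sum_op (x : X) (y : Y) (n : ℕ) :
    ∑ t : Bits n, (P.opA x (List.ofFn t) ⊗ₖ P.opB y (List.ofFn t))ᴴ *
      (P.opA x (List.ofFn t) ⊗ₖ P.opB y (List.ofFn t)) = 1 := by
  induction n with
  | zero => simp [opA, opB]
  | succ n ih =>
    rw [sum_bits_succ n fun h => (P.opA x h ⊗ₖ P.opB y h)ᴴ * (P.opA x h ⊗ₖ P.opB y h), ← ih]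
    refine Finset.sum_congr rfl fun t _ => ?_
    cases hs : P.sender (List.ofFn t) with
    | alice =>
      simp only [opA, opB, hs]
      exact sum_kraus_alice _ _ _
    | bob =>
      simp only [opA, opB, hs]
      exact sum_kraus_bob _ _ _

lemma sum_fin (x : X) (y : Y) :
    ∑ p, ∑ q, ∑ t : Bits P.cost,
      (P.finA x (List.ofFn t) p ⊗ₖ P.finB y (List.ofFn t) q)ᴴ *
        (P.finA x (List.ofFn t) p ⊗ₖ P.finB y (List.ofFn t) q) = 1 := by
  rw [← P.sum_op x y P.cost]
  simp_rw [Finset.sum_comm (s := Finset.univ (α := Bool)) (t := Finset.univ (α := Bits P.cost))]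
  refine Finset.sum_congr rfl fun t _ => ?_
  simp only [finA, finB, sum_kraus_bob, sum_kraus_alice]

/-! ### Effects of the outputs, and the rank bound. -/

/-- The operator that measures whether Alice outputs `p` and Bob outputs `q`. -/
noncomputable def effect (x : X) (y : Y) (p q : Bool) :
    Matrix (Register P.epr P.ancA × Register P.epr P.ancB)
      (Register P.epr P.ancA × Register P.epr P.ancB) ℂ :=
  ∑ t : Bits P.cost, (P.finA x (List.ofFn t) p ⊗ₖ P.finB y (List.ofFn t) q)ᴴ *
    (P.finA x (List.ofFn t) p ⊗ₖ P.finB y (List.ofFn t) q)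

lemma ofReal_outputProb (x : X) (y : Y) (p q : Bool) :
    ((P.outputProb x y p q : ℝ) : ℂ) = star (initialState P.epr P.ancA P.ancB) ⬝ᵥ
      (P.effect x y p q *ᵥ initialState P.epr P.ancA P.ancB) := by
  simp only [outputProb, effect, measure_finalState_eq, sum_mulVec, dotProduct_sum,
    ← sum_norm_sq_mulVec]
  push_cast
  rfl

lemma outputProb_nonneg (x : X) (y : Y) (p q : Bool) : 0 ≤ P.outputProb x y p q :=
  Finset.sum_nonneg fun _ _ => Finset.sum_nonneg fun _ _ => sq_nonneg _

lemma sum_outputProb (x : X) (y : Y) : ∑ p, ∑ q, P.outputProb x y p q = 1 := by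
  have h : ((∑ p, ∑ q, P.outputProb x y p q : ℝ) : ℂ) = 1 := by
    push_cast
    simp only [ofReal_outputProb, ← dotProduct_sum, ← sum_mulVec]
    simp only [effect, sum_fin, one_mulVec]
    exact star_initialState_dotProduct _ _ _
  exact_mod_cast h

/-- An outcome of probability zero annihilates the initial state. -/
lemma effect_mulVec_eq_zero {x : X} {y : Y} {p q : Bool} (h : P.outputProb x y p q = 0) :
    P.effect x y p q *ᵥ initialState P.epr P.ancA P.ancB = 0 := by
  rw [effect, sum_mulVec]
  refine Finset.sum_eq_zero fun t _ => ?_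
  rw [outputProb, Finset.sum_eq_zero_iff_of_nonneg
    fun _ _ => Finset.sum_nonneg fun _ _ => sq_nonneg _] at h
  have h1 := h t (Finset.mem_univ t)
  rw [Finset.sum_eq_zero_iff_of_nonneg fun _ _ => sq_nonneg _] at h1
  have h2 : (P.finA x (List.ofFn t) p ⊗ₖ P.finB y (List.ofFn t) q) *ᵥ
      initialState P.epr P.ancA P.ancB = 0 := by
    rw [← measure_finalState_eq]
    ext s
    exact norm_eq_zero.1 (pow_eq_zero_iff two_ne_zero |>.1 (h1 s (Finset.mem_univ s)))
  rw [← mulVec_mulVec, h2, mulVec_zero]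

/-- The initial state is an eigenvector, with eigenvalue `f x y`, of the effect of the output `1`
in an exact protocol. -/
lemma Computes.effect_mulVec {P : Protocol X Y} {f : X → Y → Bool} (hP : P.Computes f)
    (x : X) (y : Y) :
    P.effect x y true true *ᵥ initialState P.epr P.ancA P.ancB =
      (if f x y then (1 : ℂ) else 0) • initialState P.epr P.ancA P.ancB := by
  have hs := P.sum_outputProb x y
  have hf := hP x y
  have h00 := P.outputProb_nonneg x y false false
  have h01 := P.outputProb_nonneg x y false true
  have h10 := P.outputProb_nonneg x y true false
  have h11 := P.outputProb_nonneg x y true true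
  simp only [Fintype.sum_bool] at hs
  cases hxy : f x y with
  | false =>
    rw [hxy] at hf
    rw [effect_mulVec_eq_zero P (by linarith)]
    simp
  | true =>
    rw [hxy] at hf
    -- The four effects sum to the identity and the other three annihilate the initial state, so
    -- this one fixes it.
    have hsum : ∑ p, ∑ q, P.effect x y p q = 1 := P.sum_fin x y
    have h := congrArg (· *ᵥ initialState P.epr P.ancA P.ancB) hsum
    simp only [Fintype.sum_bool, add_mulVec, one_mulVec] at h
    rw [effect_mulVec_eq_zero P (p := true) (q := false) (by linarith),
      effect_mulVec_eq_zero P (p := false) (q := true) (by linarith),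
      effect_mulVec_eq_zero P (p := false) (q := false) (by linarith)] at h
    simpa using h

/-- The eigenvector equation at zero private qubits, divided by the common amplitude. The pair `(t,
w)` is the inner index of the factorization. -/
lemma Computes.sum_mul_eq {P : Protocol X Y} {f : X → Y → Bool} (hP : P.Computes f)
    (x : X) (y : Y) (u v : Bits P.epr) :
    ∑ t : Bits P.cost, ∑ w,
      ((P.finA x (List.ofFn t) true)ᴴ * P.finA x (List.ofFn t) true)
          (zeroPriv _ u) (zeroPriv _ w) *
        ((P.finB y (List.ofFn t) true)ᴴ * P.finB y (List.ofFn t) true)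
          (zeroPriv _ v) (zeroPriv _ w) =
      (if f x y then (1 : ℂ) else 0) * if u = v then 1 else 0 := by
  have h := congrFun (hP.effect_mulVec x y) (zeroPriv _ u, zeroPriv _ v)
  rw [effect, sum_mulVec, Finset.sum_apply, Pi.smul_apply, initialState_zeroPriv] at h
  simp only [conjTranspose_kronecker, ← mul_kronecker_mul, mulVec, dotProduct,
    sum_mul_initialState, ← Finset.sum_mul, kronecker_apply] at h
  apply mul_right_cancel₀ (eprAmp_ne_zero P.epr)
  rw [h, smul_eq_mul, mul_assoc, ite_mul _ 1 0 (eprAmp _), one_mul, zero_mul]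

lemma Computes.rank_le [Fintype X] [Fintype Y] {P : Protocol X Y} {f : X → Y → Bool}
    (hP : P.Computes f) : (commMatrix f).rank ≤ 2 ^ P.cost := by
  have h := rank_le_of_kronecker_one_eq_mul (T := Bits P.cost) (K := Bits P.epr) (commMatrix f)
    (of fun i j => ((P.finA i.1 (List.ofFn j.1) true)ᴴ * P.finA i.1 (List.ofFn j.1) true)
      (zeroPriv _ i.2) (zeroPriv _ j.2))
    (of fun j i => ((P.finB i.1 (List.ofFn j.1) true)ᴴ * P.finB i.1 (List.ofFn j.1) true)
      (zeroPriv _ i.2) (zeroPriv _ j.2)) (by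
        ext ⟨x, u⟩ ⟨y, v⟩
        simp only [kronecker_apply, mul_apply (M := of _), of_apply, map_apply,
          Fintype.sum_prod_type, one_apply]
        rw [hP.sum_mul_eq x y u v]
        cases hxy : f x y <;> simp [commMatrix, hxy])
  simpa using h

end Protocol

end QComm

theorem mainTheorem4 {X Y : Type*} [Fintype X] [Fintype Y] (f : X → Y → Bool) :
    Real.logb 2 ((QComm.commMatrix f).rank : ℝ) ≤ (QComm.cStar f : ℝ) := by
  -- Existence of some exact protocol matters: the infimum of an empty set would be 0.
  obtain ⟨P, hcost, hP⟩ := Nat.sInf_mem (s := {l : ℕ | ∃ P : QComm.Protocol X Y,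
    P.cost = l ∧ P.Computes f}) (QComm.exists_protocol f)
  have h : (QComm.commMatrix f).rank ≤ 2 ^ QComm.cStar f := by
    have := hP.rank_le
    rwa [hcost] at this
  rcases Nat.eq_zero_or_pos (QComm.commMatrix f).rank with h0 | h0
  -- Here `Real.logb 2 0 = 0`, so rank 0 is harmless.
  · rw [h0, Nat.cast_zero, Real.logb_zero]
    exact Nat.cast_nonneg _
  · rw [Real.logb_le_iff_le_rpow one_lt_two (by exact_mod_cast h0), Real.rpow_natCast]
    exact_mod_cast h
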